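/- **Setting.** There are $n$ users and $k$ arms. User $i$ has an unknown parameter $\theta_i\in\mathbb R^d$. In round $t=1,2,\dots$ a user $i_t$ is served and contexts $x_{1,t},\dots,x_{k,t}\in\mathbb R^d$ are revealed. Conditionally on $i_t$ and the past data, these are i.i.d. copies of a random vector $X$ with $\|X\|=1$ such that $\mathbb E[XX^{\top}]$ has smallest eigenvalue $\lambda>0$. The learner pulls some $x_t\in\{x_{1,t},\dots,x_{k,t}\}$ and observes $r_t=\theta_{i_t}^{\top}x_t+\eta_t$, where $\eta_t\sim\mathcal N(0,\sigma^2)$, $\sigma>0$, is independent of what precedes it. Let $m_{i,t}$ be the number of rounds among $1,\dots,t$ in which user $i$ is served, and put $$A_{i,t}=I+\sum_{s\le t,\ i_s=i}x_sx_s^{\top},\qquad b_{i,t}=\sum_{s\le t,\ i_s=i}r_sx_s,\qquad \hat\theta_{i,t}=A_{i,t}^{-1}b_{i,t}.$$ Let $\gamma>0$, $0<\delta<1$, $\delta'=\delta/n$, $H=\delta'/(2nd)$. The confidence radius is $$B_{i,t}=\frac{\sigma\sqrt{2d\log t+2\log(2/\delta')}+1}{\sqrt{1+h(m_{i,t},H)}},\qquad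 h(m,H)=\Big(\tfrac{\lambda m}{4}-8\log\tfrac{m+3}{H}-2\sqrt{m\log\tfrac{m+3}{H}}\Big)_+ .$$ **Clustering module of LOCB.** Given a set $S$ of seed users, every seed $s\in S$ is initially active and has cluster $\mathcal N_{s,0}=\{1,\dots,n\}$. At the end of round $t$, for each active seed $s$: if $\|\hat\theta_{i_t,t}-\hat\theta_{s,t}\|>B_{i_t,t}+B_{s,t}$ then $\mathcal N_{s,t}=\mathcal N_{s,t-1}\setminus\{i_t\}$, otherwise $\mathcal N_{s,t}=\mathcal N_{s,t-1}\cup\{i_t\}$; then $s$ becomes inactive, and its cluster is frozen, if $\sup_{i\in\mathcal N_{s,t}}B_{i,t}<\gamma/8$. The module terminates at the first round $\hat T$ after which no seed is active. **Pulling module of LOCB.** With an exploration parameter $\alpha$, write $\beta_{j,t}(x)=\alpha\sqrt{x^{\top}A_{j,t}^{-1}x}$. If some of the current clusters $\mathcal N_{s,t-1}$, $s\in S$, contain $i_t$, the pulled arm maximizes over $x\in\{x_{1,t},\dots,x_{k,t}\}$ the largest value, over these clusters, of $\frac1{|\mathcal N_{s,t-1}|}\sum_{j\in\mathcal N_{s,t-1}}\big(\hat\theta_{j,t-1}^{\top}x+\beta_{j,t-1}(x)\big)$;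 otherwise it maximizes $\hat\theta_{i_t,t-1}^{\top}x+\beta_{i_t,t-1}(x)$. **Theorem.** Let $C=\dfrac{\lambda\gamma^2}{16^3\sigma^2}$ and $$\bar U=\frac{2nd}{C}\log\frac{nd}{C}+\frac{2n}{C}\Big(\log\frac{2^{d+1}n}{\delta}-\frac{\gamma^2-256}{512\sigma^2}\Big)+n .$$ Suppose that the users are served evenly (almost surely, after every $q$ iterations of $n$ rounds each user has been served exactly $q$ times) and that, almost surely, at some round $t$ before termination ($t<\hat T$) or before the bound ($t<\bar U$), for all users $i$, $$m_{i,t}\ \ge\ \frac{2\cdot 32^2}{\lambda^2}\log\Big(\frac{2nd}{\delta'}\Big)\log\Big(\frac{32^2}{\lambda^2}\log\Big(\frac{2nd}{\delta'}\Big)\Big).$$ Then, with probability at least $1-\delta$, the Clustering module terminates and $\hat T<\bar U$. Moreover, for fixed $\sigma,\lambda,\gamma,\delta$, the expression $\bar U$ is $O(n\log n)$ as $n\to\infty$ with $d$ fixed, and $O(nd\log(nd))$ as $n,d\to\infty$. -/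

import Mathlib

open MeasureTheory ProbabilityTheory Filter Asymptotics
open scoped Matrix

noncomputable section

namespace LOCB

/-- The space `ℝ^d` with the Euclidean norm, in which contexts and bandit parameters live. -/
abbrev Vec (d : ℕ) : Type := EuclideanSpace ℝ (Fin d)

/-! ### The confidence radius -/

/-- `h(m, H) = (λ m / 4 - 8 log ((m + 3) / H) - 2 √(m log ((m + 3) / H)))_+`.  The positive part
belongs to the confidence bound of CLUB; it keeps the radius below well defined for small `m`. -/
def hFun (lam : ℝ) (m : ℕ) (H : ℝ) : ℝ :=
  max 0 (lam * m / 4 - 8 * Real.log ((m + 3) / H) - 2 * √(m * Real.log ((m + 3) / H)))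

/-- The confidence radius `B(m, δ')` at round `t` of a user that has been served `m` times:
`(σ √(2 d log t + 2 log (2 / δ')) + 1) / √(1 + h(m, H))` with `H = δ' / (2 n d)`. -/
def radius (n d : ℕ) (sigma lam delta' : ℝ) (t m : ℕ) : ℝ :=
  (sigma * √(2 * d * Real.log t + 2 * Real.log (2 / delta')) + 1) /
    √(1 + hFun lam m (delta' / (2 * n * d)))

/-! ### Statistics of the users

`Path` records, for each round `t = 1, 2, …`, the served user `i_t`, the pulled context vector
`x_t` and the observed reward `r_t`.  The entries with index `0` are never used. -/

/-- The observations of a learner along one realization. -/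
structure Path (n d : ℕ) where
  user : ℕ → Fin n
  pulled : ℕ → Vec d
  reward : ℕ → ℝ

variable {n d k : ℕ}

/-- The rounds up to `t` in which user `i` is served. -/
def served (p : Path n d) (i : Fin n) (t : ℕ) : Finset ℕ :=
  (Finset.Icc 1 t).filter fun s => p.user s = i

/-- `m_{i,t}`: the number of times that user `i` has been served up to round `t`. -/
def count (p : Path n d) (i : Fin n) (t : ℕ) : ℕ := (served p i t).card

/-- `A_{i,t} = I + ∑ x xᵀ` over the history of user `i` up to round `t`. -/
def gram (p : Path n d) (i : Fin n) (t : ℕ) : Matrix (Fin d) (Fin d) ℝ :=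
  1 + ∑ s ∈ served p i t, Matrix.vecMulVec (p.pulled s).ofLp (p.pulled s).ofLp

/-- `b_{i,t} = ∑ r x` over the history of user `i` up to round `t`. -/
def bVec (p : Path n d) (i : Fin n) (t : ℕ) : Vec d :=
  ∑ s ∈ served p i t, p.reward s • p.pulled s

/-- `θ̂_{i,t} = A_{i,t}⁻¹ b_{i,t}`. -/
def thetaHat (p : Path n d) (i : Fin n) (t : ℕ) : Vec d :=
  WithLp.toLp 2 ((gram p i t)⁻¹ *ᵥ (bVec p i t).ofLp)

/-! ### The Clustering module -/

/-- The current set `S` of seeds still being explored, and the current clusters `𝒩_s`. -/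
structure ClusterState (n : ℕ) where
  active : Finset (Fin n)
  cluster : Fin n → Finset (Fin n)

open Classical in
/-- The cluster of `s` after a round in which user `u` was served: for an active seed, `u` is
removed if its estimate is too far from that of `s`, and kept (or put back) otherwise. -/
def newCluster (B : Fin n → ℝ) (est : Fin n → Vec d) (u : Fin n) (st : ClusterState n)
    (s : Fin n) : Finset (Fin n) :=
  if s ∈ st.active then
    if ‖est u - est s‖ > B u + B s then (st.cluster s).erase u else insert u (st.cluster s)
  else st.cluster s

open Classical in
/-- One call of the Clustering procedure, with confidence radii `B` and estimates `est`: an active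
seed `s` is dropped as soon as `sup {B i : i ∈ 𝒩_s} < γ / 8` (a supremum over a finite set). -/
def clusterStep (gamma : ℝ) (B : Fin n → ℝ) (est : Fin n → Vec d) (u : Fin n)
    (st : ClusterState n) : ClusterState n where
  active := st.active.filter fun s => ¬ ∀ i ∈ newCluster B est u st s, B i < gamma / 8
  cluster := newCluster B est u st

/-- The state of the Clustering module at the end of round `t`, with `δ' = δ / n`.  Initially all
seeds are active and every cluster is the set of all users. -/
def clusterState (sigma lam gamma delta : ℝ) (S : Finset (Fin n)) (p : Path n d) :
    ℕ → ClusterState n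
  | 0 => ⟨S, fun _ => Finset.univ⟩
  | t + 1 => clusterStep gamma
      (fun i => radius n d sigma lam (delta / n) (t + 1) (count p i (t + 1)))
      (fun i => thetaHat p i (t + 1)) (p.user (t + 1))
      (clusterState sigma lam gamma delta S p t)

/-- `T̂`: the number of rounds after which no seed is active any more (`⊤` if this never
happens). -/
def termTime (sigma lam gamma delta : ℝ) (S : Finset (Fin n)) (p : Path n d) : ℕ∞ :=
  sInf ((fun t : ℕ => (t : ℕ∞)) '' {t | (clusterState sigma lam gamma delta S p t).active = ∅})

/-! ### The Pulling module -/

/-- `CB_{r,i} = α √(yᵀ A_{i,t}⁻¹ y)`, for a context vector `y`. -/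
def userBonus (alpha : ℝ) (p : Path n d) (i : Fin n) (t : ℕ) (y : Vec d) : ℝ :=
  alpha * √(y.ofLp ⬝ᵥ ((gram p i t)⁻¹ *ᵥ y.ofLp))

/-- The upper confidence value of the context vector `y` for user `i`. -/
def userScore (alpha : ℝ) (p : Path n d) (i : Fin n) (t : ℕ) (y : Vec d) : ℝ :=
  (thetaHat p i t).ofLp ⬝ᵥ y.ofLp + userBonus alpha p i t y

/-- The upper confidence value of the context vector `y` for a cluster `C`: the average estimate of
`C` applied to `y`, plus the average of the bonuses of its users. -/
def clusterScore (alpha : ℝ) (p : Path n d) (C : Finset (Fin n)) (t : ℕ) (y : Vec d) : ℝ :=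
  ((C.card : ℝ)⁻¹ • ∑ j ∈ C, thetaHat p j t).ofLp ⬝ᵥ y.ofLp +
    (C.card : ℝ)⁻¹ * ∑ j ∈ C, userBonus alpha p j t y

/-- `S_{t+1}(i)`: the seeds whose cluster at the end of round `t` contains user `i`. -/
def seedsOf (sigma lam gamma delta : ℝ) (S : Finset (Fin n)) (p : Path n d) (t : ℕ) (i : Fin n) :
    Finset (Fin n) :=
  S.filter fun s => i ∈ (clusterState sigma lam gamma delta S p t).cluster s

open Classical in
/-- The value of the context vector `y` in round `t + 1`: the largest value among the clusters that
contain the served user, or the value for the user alone if there is no such cluster. -/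
def armScore (sigma lam gamma delta alpha : ℝ) (S : Finset (Fin n)) (p : Path n d) (t : ℕ)
    (y : Vec d) : ℝ :=
  if hS : (seedsOf sigma lam gamma delta S p t (p.user (t + 1))).Nonempty then
    (seedsOf sigma lam gamma delta S p t (p.user (t + 1))).sup' hS fun s =>
      clusterScore alpha p ((clusterState sigma lam gamma delta S p t).cluster s) t y
  else userScore alpha p (p.user (t + 1)) t y

/-! ### The stochastic model -/

variable {Ω : Type*} [MeasurableSpace Ω]

/-- The reward `r_t = θ_{i_t}ᵀ x_t + η_t` of the pulled arm. -/
def reward (theta : Fin n → Vec d) (user : ℕ → Ω → Fin n) (ctx : ℕ → Ω → Fin k → Vec d)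
    (arm : ℕ → Ω → Fin k) (noise : ℕ → Ω → ℝ) (t : ℕ) (ω : Ω) : ℝ :=
  (theta (user t ω)).ofLp ⬝ᵥ (ctx t ω (arm t ω)).ofLp + noise t ω

/-- The observations made along the realization `ω`. -/
def pathOf (theta : Fin n → Vec d) (user : ℕ → Ω → Fin n) (ctx : ℕ → Ω → Fin k → Vec d)
    (arm : ℕ → Ω → Fin k) (noise : ℕ → Ω → ℝ) (ω : Ω) : Path n d where
  user t := user t ω
  pulled t := ctx t ω (arm t ω)
  reward t := reward theta user ctx arm noise t ω

/-- The σ-algebra generated by the data (users, contexts, pulled arms, rewards) of the rounds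
`1, …, t`. -/
abbrev past (theta : Fin n → Vec d) (user : ℕ → Ω → Fin n) (ctx : ℕ → Ω → Fin k → Vec d)
    (arm : ℕ → Ω → Fin k) (noise : ℕ → Ω → ℝ) (t : ℕ) : MeasurableSpace Ω :=
  ⨆ s ∈ Finset.Icc 1 t, MeasurableSpace.comap
    (fun ω => (user s ω, ctx s ω, arm s ω, reward theta user ctx arm noise s ω)) inferInstance

/-- The matrix `E[X Xᵀ]` of a random vector `X` with law `ν`. -/
def secondMoment (ν : Measure (Vec d)) : Matrix (Fin d) (Fin d) ℝ :=
  Matrix.of fun a b => ∫ x, x a * x b ∂ν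

/-- The law `ν` of the random context vector `X`: `‖X‖ = 1`, and `E[X Xᵀ]` has full rank with
smallest eigenvalue `λ > 0`. -/
structure IsContextLaw (ν : Measure (Vec d)) (lam : ℝ) : Prop where
  isProbabilityMeasure : IsProbabilityMeasure ν
  norm_eq_one : ∀ᵐ x ∂ν, ‖x‖ = 1
  isLeast_eigenvalue :
    IsLeast {μ : ℝ | Module.End.HasEigenvalue (Matrix.toLin' (secondMoment ν)) μ} lam
  pos : 0 < lam

/-- The linear contextual bandit with `n` users and `k` arms, parameters `θ_i`, context law `ν` and
Gaussian noise `𝒩(0, σ²)`: in each round, conditionally on the served user and the past data, the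
contexts of the arms are i.i.d. with law `ν`, and the noise is independent of everything that
precedes it. -/
structure IsLinearBandit (P : Measure Ω) (theta : Fin n → Vec d) (ν : Measure (Vec d)) (sigma : ℝ)
    (user : ℕ → Ω → Fin n) (ctx : ℕ → Ω → Fin k → Vec d) (arm : ℕ → Ω → Fin k)
    (noise : ℕ → Ω → ℝ) : Prop where
  measurable_user : ∀ t, Measurable (user t)
  measurable_ctx : ∀ t, Measurable (ctx t)
  measurable_arm : ∀ t, Measurable (arm t)
  measurable_noise : ∀ t, Measurable (noise t)
  ctx_law : ∀ t, P.map (ctx (t + 1)) = Measure.pi fun _ : Fin k => ν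
  ctx_indep : ∀ t, Indep (MeasurableSpace.comap (ctx (t + 1)) inferInstance)
    (past theta user ctx arm noise t ⊔ MeasurableSpace.comap (user (t + 1)) inferInstance) P
  noise_law : ∀ t, P.map (noise (t + 1)) = gaussianReal 0 (sigma ^ 2).toNNReal
  noise_indep : ∀ t, Indep (MeasurableSpace.comap (noise (t + 1)) inferInstance)
    (past theta user ctx arm noise t ⊔ MeasurableSpace.comap
      (fun ω => (user (t + 1) ω, ctx (t + 1) ω, arm (t + 1) ω)) inferInstance) P

/-- The arms are pulled by LOCB: in every round the pulled arm maximizes the value used by the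
Pulling module (ties are broken arbitrarily). -/
def PullsByLOCB (P : Measure Ω) (sigma lam gamma delta alpha : ℝ) (S : Finset (Fin n))
    (theta : Fin n → Vec d) (user : ℕ → Ω → Fin n) (ctx : ℕ → Ω → Fin k → Vec d)
    (arm : ℕ → Ω → Fin k) (noise : ℕ → Ω → ℝ) : Prop :=
  ∀ᵐ ω ∂P, ∀ t : ℕ, ∀ a : Fin k,
    armScore sigma lam gamma delta alpha S (pathOf theta user ctx arm noise ω) t
        (ctx (t + 1) ω a) ≤
      armScore sigma lam gamma delta alpha S (pathOf theta user ctx arm noise ω) t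
        (ctx (t + 1) ω (arm (t + 1) ω))

/-- The users are served evenly: after `q` iterations of `n` rounds, every user has been served
exactly `q` times. -/
def EvenlyServed (p : Path n d) : Prop := ∀ (q : ℕ) (i : Fin n), count p i (q * n) = q

/-! ### The quantities in the bound -/

/-- The threshold `(2 · 32² / λ²) log (2nd / δ') log ((32² / λ²) log (2nd / δ'))`. -/
def threshold (n d : ℕ) (lam delta' : ℝ) : ℝ :=
  2 * 32 ^ 2 / lam ^ 2 * Real.log (2 * n * d / delta') *
    Real.log (32 ^ 2 / lam ^ 2 * Real.log (2 * n * d / delta'))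

/-- `C = λ γ² / (16³ σ²)`. -/
def constC (sigma lam gamma : ℝ) : ℝ := lam * gamma ^ 2 / (16 ^ 3 * sigma ^ 2)

/-- The bound on the number of rounds. -/
def roundBound (sigma lam gamma delta : ℝ) (n d : ℕ) : ℝ :=
  2 * n * d / constC sigma lam gamma * Real.log (n * d / constC sigma lam gamma) +
    2 * n / constC sigma lam gamma *
      (Real.log (2 ^ (d + 1) * n / delta) - (gamma ^ 2 - 256) / (512 * sigma ^ 2)) + n

end LOCB

end

/-!
The event in the theorem holds on every realization in which the users are served evenly.  At
round `q n` each user has been served `q` times, so all radii are equal; as soon as they are below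
`γ / 8`, every seed becomes inactive, whatever its cluster is, and no concentration inequality is
needed.

That `‖X‖ = 1` forces `λ ≤ 1`.  Then `h(q, H) ≥ λ q / 8` once `q` is beyond the threshold, and the
radius is below `γ / 8` if `4 σ² (d log (q n) + log (2 / δ')) + 2 < (γ / 8)² (1 + λ q / 8)`, where
the left side uses `(a + 1)² ≤ 2 a² + 2`.  Bounding `log (q n)` by the tangent line to `log` at
`2 n d / C` shows that `q n ≥ Ū - n` is enough.  By pigeonhole, if all users have reached the
threshold at some round `t < (q + 1) n`, then `q` is beyond it.  Hence `t ≥ Ū` would give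
`T̂ ≤ ⌊t / n⌋ n ≤ t`, which excludes the case `Ū ≤ t < T̂`; and for `t < Ū` the last multiple of
`n` before `Ū` bounds `T̂`.
-/

namespace LOCB

variable {n d : ℕ} {sigma lam gamma delta delta' : ℝ}

/-! ### Second moments -/

section SecondMoment

variable {ν : Measure (Vec d)}

lemma integrable_apply_mul_apply (hν : MemLp id 2 ν) (a b : Fin d) :
    Integrable (fun x : Vec d => x a * x b) ν :=
  (memLp_piLp_iff.1 hν a).integrable_mul (memLp_piLp_iff.1 hν b)

lemma real_inner_eq_sum (v x : Vec d) : inner ℝ v x = ∑ a, v a * x a := by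
  simp [PiLp.inner_apply, mul_comm]

lemma secondMoment_mulVec_apply (hν : MemLp id 2 ν) (v : Vec d) (a : Fin d) :
    (secondMoment ν *ᵥ v.ofLp) a = ∫ x, x a * inner ℝ v x ∂ν := by
  calc (secondMoment ν *ᵥ v.ofLp) a = ∑ b, ∫ x, x a * x b * v b ∂ν := by
        simp only [Matrix.mulVec, dotProduct, secondMoment, Matrix.of_apply, integral_mul_const]
    _ = ∫ x, ∑ b, x a * x b * v b ∂ν :=
        (integral_finsetSum _ fun b _ => (integrable_apply_mul_apply hν a b).mul_const _).symm
    _ = ∫ x, x a * inner ℝ v x ∂ν := by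
        simp only [real_inner_eq_sum, Finset.mul_sum, mul_assoc, mul_comm (v _)]

lemma dotProduct_secondMoment_mulVec (hν : MemLp id 2 ν) (v : Vec d) :
    v.ofLp ⬝ᵥ (secondMoment ν *ᵥ v.ofLp) = ∫ x, inner ℝ v x ^ 2 ∂ν := by
  have hint (a : Fin d) : Integrable (fun x : Vec d => x a * inner ℝ v x) ν :=
    (memLp_piLp_iff.1 hν a).integrable_mul (hν.const_inner v)
  calc v.ofLp ⬝ᵥ (secondMoment ν *ᵥ v.ofLp) = ∑ a, ∫ x, v a * (x a * inner ℝ v x) ∂ν := by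
        simp only [dotProduct, secondMoment_mulVec_apply hν, integral_const_mul]
    _ = ∫ x, ∑ a, v a * (x a * inner ℝ v x) ∂ν :=
        (integral_finsetSum _ fun a _ => (hint a).const_mul _).symm
    _ = ∫ x, inner ℝ v x ^ 2 ∂ν := by
        simp only [← mul_assoc, ← Finset.sum_mul, ← real_inner_eq_sum, sq]

lemma le_integral_norm_sq_of_hasEigenvalue (hν : MemLp id 2 ν) {μ : ℝ}
    (hμ : Module.End.HasEigenvalue (Matrix.toLin' (secondMoment ν)) μ) :
    μ ≤ ∫ x, ‖x‖ ^ 2 ∂ν := by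
  obtain ⟨v, hv⟩ := hμ.exists_hasEigenvector
  set w : Vec d := WithLp.toLp 2 v with hw
  have hw0 : 0 < ‖w‖ ^ 2 := by
    have : w ≠ 0 := fun h => hv.2 (by simpa [hw] using h)
    positivity
  have heigen : secondMoment ν *ᵥ w.ofLp = μ • w.ofLp := by
    simpa [hw] using hv.apply_eq_smul
  have hcauchy (x : Vec d) : inner ℝ w x ^ 2 ≤ ‖w‖ ^ 2 * ‖x‖ ^ 2 := by
    rw [← mul_pow, ← sq_abs]
    exact pow_le_pow_left₀ (abs_nonneg _) (abs_real_inner_le_norm w x) 2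
  have hquad : ‖w‖ ^ 2 * μ ≤ ‖w‖ ^ 2 * ∫ x, ‖x‖ ^ 2 ∂ν :=
    calc ‖w‖ ^ 2 * μ = w.ofLp ⬝ᵥ (secondMoment ν *ᵥ w.ofLp) := by
          rw [heigen, dotProduct_smul, EuclideanSpace.real_norm_sq_eq, smul_eq_mul, mul_comm]
          simp only [dotProduct, sq]
      _ = ∫ x, inner ℝ w x ^ 2 ∂ν := dotProduct_secondMoment_mulVec hν w
      _ ≤ ∫ x, ‖w‖ ^ 2 * ‖x‖ ^ 2 ∂ν :=
          integral_mono (hν.const_inner w).integrable_sq (hν.norm.integrable_sq.const_mul _) hcauchy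
      _ = ‖w‖ ^ 2 * ∫ x, ‖x‖ ^ 2 ∂ν := integral_const_mul _ _
  exact le_of_mul_le_mul_left hquad hw0

lemma IsContextLaw.dim_pos (h : IsContextLaw ν lam) : 0 < d := by
  have := h.isProbabilityMeasure
  obtain ⟨x, hx⟩ := h.norm_eq_one.exists
  refine Nat.pos_of_ne_zero ?_
  rintro rfl
  simp [Subsingleton.elim x 0] at hx

lemma IsContextLaw.le_one (h : IsContextLaw ν lam) : lam ≤ 1 := by
  have := h.isProbabilityMeasure
  have hν : MemLp id 2 ν :=
    MemLp.of_bound aestronglyMeasurable_id 1 (h.norm_eq_one.mono fun x hx => hx.le)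
  calc lam ≤ ∫ x, ‖x‖ ^ 2 ∂ν := le_integral_norm_sq_of_hasEigenvalue hν h.isLeast_eigenvalue.1
    _ = ∫ _x, 1 ∂ν := integral_congr_ae (h.norm_eq_one.mono fun x hx => by simp [hx])
    _ = 1 := by simp

end SecondMoment

/-! ### The confidence radius -/

lemma log_le_div_add_log_sub_one {x a : ℝ} (hx : 0 < x) (ha : 0 < a) :
    Real.log x ≤ x / a + Real.log a - 1 := by
  have := Real.log_le_sub_one_of_pos (div_pos hx ha)
  rw [Real.log_div hx.ne' ha.ne'] at this
  linarith

lemma mul_log_le_of_two_mul_mul_log_le {A M : ℝ} (hA : 0 < A) (hM : 0 < M)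
    (h : 2 * A * Real.log A ≤ M) : A * Real.log M ≤ M := by
  have hlog2 : A * Real.log 2 ≤ A * 1 := by
    gcongr
    linarith [Real.log_two_lt_d9]
  calc A * Real.log M ≤ A * (M / (2 * A) + Real.log (2 * A) - 1) := by
        gcongr
        exact log_le_div_add_log_sub_one hM (by positivity)
    _ = M / 2 + A * Real.log A + (A * Real.log 2 - A) := by
        rw [Real.log_mul two_ne_zero hA.ne']
        field_simp
        ring
    _ ≤ M := by linarith

lemma one_le_log_of_three_le {x : ℝ} (hx : 3 ≤ x) : 1 ≤ Real.log x := by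
  rw [Real.le_log_iff_exp_le (by linarith)]
  exact Real.exp_one_lt_three.le.trans hx

lemma three_le_mul_of_log_two_le {L : ℝ} (hlam : 0 < lam) (hlam1 : lam ≤ 1)
    (hL : Real.log 2 ≤ L) : 3 ≤ 32 ^ 2 / lam ^ 2 * L := by
  have hlamsq : (32 : ℝ) ^ 2 ≤ 32 ^ 2 / lam ^ 2 :=
    le_div_self (by norm_num) (by positivity) (pow_le_one₀ hlam.le hlam1)
  nlinarith [Real.log_two_gt_d9]

lemma log_add_three_add_le {L M : ℝ} (hlam : 0 < lam) (hlam1 : lam ≤ 1) (hL : Real.log 2 ≤ L)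
    (hM : 2 * (32 ^ 2 / lam ^ 2 * L) * Real.log (32 ^ 2 / lam ^ 2 * L) ≤ M) :
    Real.log (M + 3) + L ≤ lam ^ 2 * M / 400 := by
  have hA3 := three_le_mul_of_log_two_le hlam hlam1 hL
  have hLA : lam ^ 2 * (32 ^ 2 / lam ^ 2 * L) = 1024 * L := by
    rw [← mul_assoc, mul_div_cancel₀ _ (by positivity)]
    norm_num
  set A := 32 ^ 2 / lam ^ 2 * L
  have h2A : 2 * A ≤ M := by
    refine le_trans ?_ hM
    exact le_mul_of_one_le_right (by linarith) (one_le_log_of_three_le hA3)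
  have hM0 : 0 < M := by linarith
  have hL_le : 2 * L ≤ lam ^ 2 * M / 1024 := by
    have := mul_le_mul_of_nonneg_left h2A (sq_nonneg lam)
    linarith
  have hlogM : 0.69 * Real.log M ≤ lam ^ 2 * M / 1024 := by
    have hAlog : lam ^ 2 * (A * Real.log M) ≤ lam ^ 2 * M := by
      gcongr
      exact mul_log_le_of_two_mul_mul_log_le (by linarith) hM0 hM
    rw [← mul_assoc, hLA] at hAlog
    have : 0.69 * Real.log M ≤ L * Real.log M := by
      gcongr
      · exact Real.log_nonneg (by linarith)
      · linarith [Real.log_two_gt_d9]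
    linarith
  have hlogM3 : Real.log (M + 3) ≤ Real.log 2 + Real.log M := by
    rw [← Real.log_mul two_ne_zero hM0.ne']
    exact Real.log_le_log (by linarith) (by linarith)
  have hlamM : 0 ≤ lam ^ 2 * M := by positivity
  linarith

lemma log_two_le_log_div (hn : 0 < n) (hd : 0 < d) (hdelta' : 0 < delta') (hdelta'1 : delta' ≤ 1) :
    Real.log 2 ≤ Real.log (2 * n * d / delta') := by
  have hnd : (1 : ℝ) ≤ n * d := by exact_mod_cast Nat.mul_pos hn hd
  refine Real.log_le_log two_pos ?_
  rw [le_div_iff₀ hdelta']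
  linarith

lemma threshold_pos (hlam : 0 < lam) (hlam1 : lam ≤ 1) (hn : 0 < n) (hd : 0 < d)
    (hdelta' : 0 < delta') (hdelta'1 : delta' ≤ 1) : 0 < threshold n d lam delta' := by
  have hA3 := three_le_mul_of_log_two_le hlam hlam1 (log_two_le_log_div hn hd hdelta' hdelta'1)
  have hlogA := one_le_log_of_three_le hA3
  rw [threshold, mul_div_assoc, mul_assoc 2]
  positivity

lemma hFun_nonneg (lam : ℝ) (m : ℕ) (H : ℝ) : 0 ≤ hFun lam m H := le_max_left _ _

lemma le_hFun_of_threshold_le {m : ℕ} (hlam : 0 < lam) (hlam1 : lam ≤ 1) (hn : 0 < n)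
    (hd : 0 < d) (hdelta' : 0 < delta') (hdelta'1 : delta' ≤ 1)
    (hm : threshold n d lam delta' ≤ m) :
    lam * m / 8 ≤ hFun lam m (delta' / (2 * n * d)) := by
  refine le_trans ?_ (le_max_right _ _)
  set ell := Real.log ((m + 3) / (delta' / (2 * n * d))) with hell
  -- `1 / 400` makes `8 ℓ + 2 √(m ℓ)` at most `(1 / 50 + 1 / 10) λ m < λ m / 8`.
  have hell_le : ell ≤ lam ^ 2 * m / 400 := by
    have hell_eq : ell = Real.log (m + 3) + Real.log (2 * n * d / delta') := by
      rw [hell, ← Real.log_mul (by positivity) (by positivity), div_div_eq_mul_div, mul_div_assoc]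
    rw [hell_eq]
    refine log_add_three_add_le hlam hlam1 (log_two_le_log_div hn hd hdelta' hdelta'1) ?_
    rwa [threshold, mul_div_assoc, mul_assoc 2] at hm
  have hsqrt : √(m * ell) ≤ lam * m / 20 := by
    refine Real.sqrt_le_iff.2 ⟨by positivity, ?_⟩
    calc m * ell ≤ m * (lam ^ 2 * m / 400) := by gcongr
      _ = (lam * m / 20) ^ 2 := by ring
  have hlam_sq : lam ^ 2 * m ≤ lam * m := by
    gcongr
    exact pow_le_of_le_one hlam.le hlam1 two_ne_zero
  have hlam_m : 0 ≤ lam * m := by positivity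
  linarith

lemma radius_lt {t m : ℕ} {c : ℝ} (hc : 0 ≤ c) (hdelta' : 0 < delta') (hdelta'2 : delta' ≤ 2)
    (h : 4 * sigma ^ 2 * (d * Real.log t + Real.log (2 / delta')) + 2 <
      c ^ 2 * (1 + hFun lam m (delta' / (2 * n * d)))) :
    radius n d sigma lam delta' t m < c := by
  have hh := hFun_nonneg lam m (delta' / (2 * n * d))
  have hdelta'log : 0 ≤ Real.log (2 / delta') := Real.log_nonneg ((one_le_div hdelta').2 hdelta'2)
  rw [radius, div_lt_iff₀ (by positivity)]
  refine lt_of_pow_lt_pow_left₀ 2 (by positivity) ?_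
  calc (sigma * √(2 * d * Real.log t + 2 * Real.log (2 / delta')) + 1) ^ 2
      ≤ 2 * ((sigma * √(2 * d * Real.log t + 2 * Real.log (2 / delta'))) ^ 2 + 1 ^ 2) := add_sq_le
    _ = 4 * sigma ^ 2 * (d * Real.log t + Real.log (2 / delta')) + 2 := by
        rw [mul_pow, Real.sq_sqrt (by positivity)]
        ring
    _ < c ^ 2 * (1 + hFun lam m (delta' / (2 * n * d))) := h
    _ = (c * √(1 + hFun lam m (delta' / (2 * n * d)))) ^ 2 := by
        rw [mul_pow, Real.sq_sqrt (by positivity)]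

/-! ### The bound on the number of rounds -/

lemma constC_pos (hsigma : 0 < sigma) (hlam : 0 < lam) (hgamma : 0 < gamma) :
    0 < constC sigma lam gamma := by
  unfold constC
  positivity

lemma roundBound_eq (hC : 0 < constC sigma lam gamma) (hdelta : 0 < delta) (n d : ℕ) :
    roundBound sigma lam gamma delta n d =
      n * (2 / constC sigma lam gamma *
        (d * Real.log (2 / constC sigma lam gamma * (n * d)) + Real.log (2 / delta * n) -
          (gamma ^ 2 - 256) / (512 * sigma ^ 2)) + 1) := by
  rw [roundBound]
  set C := constC sigma lam gamma
  rcases n.eq_zero_or_pos with rfl | hn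
  · simp
  have hlog_n : Real.log (2 ^ (d + 1) * n / delta) = d * Real.log 2 + Real.log (2 / delta * n) := by
    rw [← Real.log_pow, ← Real.log_mul (by positivity) (by positivity)]
    congr 1
    ring
  have hlog_nd : d * Real.log (2 / C * (n * d)) =
      d * Real.log 2 + d * Real.log (n * d / C) := by
    rcases d.eq_zero_or_pos with rfl | hd
    · simp
    rw [← mul_add, ← Real.log_mul two_ne_zero (by positivity), div_mul_eq_mul_div, mul_div_assoc]
  rw [hlog_n, hlog_nd]
  ring

/-- The tangent line to `log` at `2 n d / C` turns the bound on `x n` into one on `log (x n)`. -/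
lemma mul_log_add_log_le_of_roundBound_sub_le {x : ℝ} (hC : 0 < constC sigma lam gamma)
    (hdelta : 0 < delta) (hn : 0 < n) (hd : 0 < d) (hx : 0 < x)
    (hU : roundBound sigma lam gamma delta n d - n ≤ x * n) :
    d * Real.log (x * n) + Real.log (2 / delta * n) ≤
      constC sigma lam gamma * x + (gamma ^ 2 - 256) / (512 * sigma ^ 2) - d := by
  rw [roundBound_eq hC hdelta] at hU
  set C := constC sigma lam gamma
  set u := Real.log (2 / C * (n * d))
  have htangent : d * Real.log (x * n) ≤ C * x / 2 + d * u - d := by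
    calc d * Real.log (x * n) ≤ d * (x * n / (2 / C * (n * d)) + u - 1) := by
          gcongr
          exact log_le_div_add_log_sub_one (by positivity) (by positivity)
      _ = C * x / 2 + d * u - d := by field_simp
  have hbound : 2 / C * (d * u + Real.log (2 / delta * n) -
      (gamma ^ 2 - 256) / (512 * sigma ^ 2)) ≤ x := by
    have hn0 : (0 : ℝ) < n := by exact_mod_cast hn
    refine le_of_mul_le_mul_left ?_ hn0
    linarith
  rw [div_mul_eq_mul_div, div_le_iff₀ hC] at hbound
  linarith

lemma radius_lt_of_roundBound_sub_le {q : ℕ} (hsigma : 0 < sigma) (hlam : 0 < lam)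
    (hlam1 : lam ≤ 1) (hgamma : 0 < gamma) (hdelta : 0 < delta) (hdelta1 : delta / n ≤ 1)
    (hn : 0 < n) (hd : 0 < d) (hq0 : 0 < q) (hq : threshold n d lam (delta / n) ≤ q)
    (hU : roundBound sigma lam gamma delta n d - n ≤ (q : ℝ) * n) :
    radius n d sigma lam (delta / n) (q * n) q < gamma / 8 := by
  have hdelta' : 0 < delta / n := by positivity
  have hh := le_hFun_of_threshold_le hlam hlam1 hn hd hdelta' hdelta1 hq
  have hlog := mul_log_add_log_le_of_roundBound_sub_le (constC_pos hsigma hlam hgamma) hdelta hn hd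
    (by exact_mod_cast hq0) hU
  have hq_nonneg : 0 ≤ gamma ^ 2 * (lam * q) := by positivity
  have hgamma_sq : 0 < gamma ^ 2 := by positivity
  have hsigma_d : 0 ≤ sigma ^ 2 * d := by positivity
  refine radius_lt (by positivity) hdelta' (by linarith) ?_
  rw [Nat.cast_mul, div_div_eq_mul_div, mul_div_right_comm]
  calc 4 * sigma ^ 2 * (d * Real.log (q * n) + Real.log (2 / delta * n)) + 2
      ≤ 4 * sigma ^ 2 * (constC sigma lam gamma * q +
          (gamma ^ 2 - 256) / (512 * sigma ^ 2) - d) + 2 := by gcongr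
    _ = gamma ^ 2 * (lam * q) / 1024 + gamma ^ 2 / 128 - 4 * (sigma ^ 2 * d) := by
        rw [constC]
        field_simp
        ring
    _ < (gamma / 8) ^ 2 * (1 + lam * q / 8) := by linarith
    _ ≤ (gamma / 8) ^ 2 * (1 + hFun lam q (delta / n / (2 * n * d))) := by gcongr

/-! ### Termination along a realization -/

lemma exists_count_lt (p : Path n d) {t q : ℕ} (ht : t < n * q) : ∃ i, count p i t < q := by
  obtain ⟨i, -, hi⟩ := Finset.exists_card_fiber_lt_of_card_lt_mul (s := Finset.Icc 1 t)
    (t := Finset.univ) (f := p.user) (n := q) (by simpa using ht)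
  exact ⟨i, hi⟩

lemma termTime_le {S : Finset (Fin n)} {p : Path n d} {t : ℕ} (ht : 0 < t)
    (hB : ∀ i, radius n d sigma lam (delta / n) t (count p i t) < gamma / 8) :
    termTime sigma lam gamma delta S p ≤ t := by
  refine sInf_le ⟨t, ?_, rfl⟩
  obtain ⟨t, rfl⟩ := Nat.exists_eq_succ_of_ne_zero ht.ne'
  exact Finset.filter_false_of_mem fun s _ hs => hs fun i _ => hB i

lemma exists_nat_mul_lt_le {a U : ℝ} (ha : 0 < a) (hU : 0 < U) :
    ∃ q : ℕ, q * a < U ∧ U ≤ a * (q + 1) := by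
  have hpos : 0 < ⌈U / a⌉₊ := Nat.ceil_pos.2 (div_pos hU ha)
  obtain ⟨hlt, hle⟩ := (Nat.ceil_eq_iff hpos.ne').1 rfl
  refine ⟨⌈U / a⌉₊ - 1, (lt_div_iff₀ ha).1 hlt, ?_⟩
  rw [← Nat.cast_add_one, Nat.sub_add_cancel hpos, ← div_le_iff₀' ha]
  exact hle

section EvenlyServed

variable {S : Finset (Fin n)} {p : Path n d} {t : ℕ}

lemma termTime_le_mul {q : ℕ} (hsigma : 0 < sigma) (hlam : 0 < lam) (hlam1 : lam ≤ 1)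
    (hgamma : 0 < gamma) (hdelta : 0 < delta) (hdelta1 : delta / n ≤ 1) (hd : 0 < d)
    (hp : EvenlyServed p) (hc : ∀ i, threshold n d lam (delta / n) ≤ (count p i t : ℝ))
    (ht : t < n * (q + 1)) (hU : roundBound sigma lam gamma delta n d - n ≤ (q : ℝ) * n) :
    termTime sigma lam gamma delta S p ≤ (q * n : ℕ) := by
  obtain ⟨i, hi⟩ := exists_count_lt p ht
  have hn : 0 < n := i.pos
  have hq : threshold n d lam (delta / n) ≤ q :=
    (hc i).trans (by exact_mod_cast Nat.lt_succ_iff.1 hi)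
  have hq0 : 0 < q := by
    exact_mod_cast (threshold_pos hlam hlam1 hn hd (by positivity) hdelta1).trans_le hq
  refine termTime_le (Nat.mul_pos hq0 hn) fun i => ?_
  rw [hp q i]
  exact radius_lt_of_roundBound_sub_le hsigma hlam hlam1 hgamma hdelta hdelta1 hn hd hq0 hq hU

lemma lt_roundBound_of_lt_termTime (hsigma : 0 < sigma) (hlam : 0 < lam) (hlam1 : lam ≤ 1)
    (hgamma : 0 < gamma) (hdelta : 0 < delta) (hdelta1 : delta / n ≤ 1) (hd : 0 < d)
    (hp : EvenlyServed p) (hc : ∀ i, threshold n d lam (delta / n) ≤ (count p i t : ℝ))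
    (ht : (t : ℕ∞) < termTime sigma lam gamma delta S p) :
    (t : ℝ) < roundBound sigma lam gamma delta n d := by
  by_contra! hU
  have hn : 0 < n := (p.user 0).pos
  have hlt : t < n * (t / n + 1) := Nat.lt_mul_div_succ t hn
  have hlt' : (t : ℝ) < n * ((t / n : ℕ) + 1) := by exact_mod_cast hlt
  have hle : termTime sigma lam gamma delta S p ≤ (t / n * n : ℕ) :=
    termTime_le_mul hsigma hlam hlam1 hgamma hdelta hdelta1 hd hp hc hlt (by linarith)
  exact ht.not_ge (hle.trans (by exact_mod_cast Nat.div_mul_le_self t n))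

lemma exists_termTime_eq_lt_roundBound (hsigma : 0 < sigma) (hlam : 0 < lam) (hlam1 : lam ≤ 1)
    (hgamma : 0 < gamma) (hdelta : 0 < delta) (hdelta1 : delta / n ≤ 1) (hd : 0 < d)
    (hp : EvenlyServed p) (hc : ∀ i, threshold n d lam (delta / n) ≤ (count p i t : ℝ))
    (ht : (t : ℕ∞) < termTime sigma lam gamma delta S p ∨
      (t : ℝ) < roundBound sigma lam gamma delta n d) :
    ∃ T : ℕ, termTime sigma lam gamma delta S p = T ∧
      (T : ℝ) < roundBound sigma lam gamma delta n d := by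
  have htU : (t : ℝ) < roundBound sigma lam gamma delta n d := ht.elim
    (lt_roundBound_of_lt_termTime hsigma hlam hlam1 hgamma hdelta hdelta1 hd hp hc) id
  have hn : (0 : ℝ) < n := by exact_mod_cast (p.user 0).pos
  obtain ⟨q, hqU, hUq⟩ := exists_nat_mul_lt_le hn (t.cast_nonneg.trans_lt htU)
  have hle : termTime sigma lam gamma delta S p ≤ (q * n : ℕ) :=
    termTime_le_mul hsigma hlam hlam1 hgamma hdelta hdelta1 hd hp hc
      (by exact_mod_cast htU.trans_le hUq) (by linarith)
  obtain ⟨T, hT⟩ := ENat.ne_top_iff_exists.1 (ne_top_of_le_ne_top (ENat.natCast_ne_top _) hle)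
  refine ⟨T, hT.symm, lt_of_le_of_lt ?_ hqU⟩
  rw [← hT] at hle
  exact_mod_cast hle

end EvenlyServed

lemma one_sub_le_probReal_of_ae {Ω : Type*} [MeasurableSpace Ω] {P : Measure Ω}
    [IsProbabilityMeasure P] {s : Set Ω} (hdelta : 0 ≤ delta) (hs : ∀ᵐ ω ∂P, ω ∈ s) :
    1 - delta ≤ P.real s := by
  rw [measureReal_congr (s := s) (t := Set.univ) (eventuallyEq_univ.2 hs), probReal_univ]
  linarith

/-! ### Growth of the bound -/

lemma isBigO_log_const_mul {α : Type*} {l : Filter α} {f g : α → ℝ} (c : ℝ)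
    (h1 : (fun _ => (1 : ℝ)) =O[l] g) (hf : (fun x => Real.log (f x)) =O[l] g) :
    (fun x => Real.log (c * f x)) =O[l] g := by
  have hle (x : α) : ‖Real.log (c * f x)‖ ≤ ‖|Real.log c| + |Real.log (f x)|‖ := by
    rw [Real.norm_eq_abs, Real.norm_of_nonneg (add_nonneg (abs_nonneg _) (abs_nonneg _))]
    rcases eq_or_ne c 0 with rfl | hc
    · simp
    rcases eq_or_ne (f x) 0 with hx | hx
    · simp [hx]
    rw [Real.log_mul hc hx]
    exact abs_add_le _ _
  refine (isBigO_of_le l hle).trans (IsBigO.add ?_ hf.abs_left)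
  simpa only [mul_one] using h1.const_mul_left |Real.log c|

/-- Both asymptotic regimes of the theorem at once: `D` stands for the order of the dimension and
`ℓ` for the order of the logarithms. -/
lemma isBigO_roundBound {α : Type*} {l : Filter α} {N M : α → ℕ} {D ℓ : α → ℝ}
    (hC : 0 < constC sigma lam gamma) (hdelta : 0 < delta)
    (hD1 : (fun _ => (1 : ℝ)) =O[l] D) (hD : (fun x => (M x : ℝ)) =O[l] D)
    (hℓ1 : (fun _ => (1 : ℝ)) =O[l] ℓ) (hℓN : (fun x => Real.log (N x)) =O[l] ℓ)
    (hℓNM : (fun x => Real.log (N x * M x)) =O[l] ℓ) :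
    (fun x => roundBound sigma lam gamma delta (N x) (M x)) =O[l]
      fun x => (N x : ℝ) * (D x * ℓ x) := by
  have hconst (c : ℝ) : (fun _ => c) =O[l] fun x => D x * ℓ x := by
    simpa only [mul_one] using (hD1.mul hℓ1).const_mul_left c
  have hlogNM := hD.mul (isBigO_log_const_mul (2 / constC sigma lam gamma) hℓ1 hℓNM)
  have hlogN : (fun x => Real.log (2 / delta * N x)) =O[l] fun x => D x * ℓ x := by
    simpa only [one_mul] using hD1.mul (isBigO_log_const_mul (2 / delta) hℓ1 hℓN)
  simp only [roundBound_eq hC hdelta]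
  exact (isBigO_refl _ l).mul
    ((((hlogNM.add hlogN).sub (hconst _)).const_mul_left _).add (hconst _))

lemma isBigO_one_log_natCast : (fun _ : ℕ => (1 : ℝ)) =O[atTop] fun n : ℕ => Real.log n :=
  (isLittleO_const_left.2 (.inr (tendsto_norm_atTop_atTop.comp
    (Real.tendsto_log_atTop.comp tendsto_natCast_atTop_atTop)))).isBigO

lemma isBigO_roundBound_left (hC : 0 < constC sigma lam gamma) (hdelta : 0 < delta) (d : ℕ) :
    (fun n : ℕ => roundBound sigma lam gamma delta n d) =O[atTop]
      fun n : ℕ => (n : ℝ) * Real.log n := by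
  have hlog : (fun n : ℕ => Real.log (n * d)) =O[atTop] fun n : ℕ => Real.log n := by
    simpa only [mul_comm] using
      isBigO_log_const_mul (d : ℝ) isBigO_one_log_natCast (isBigO_refl _ _)
  simpa only [one_mul] using isBigO_roundBound hC hdelta (isBigO_refl (fun _ => (1 : ℝ)) atTop)
    (isBigO_const_const _ one_ne_zero _) isBigO_one_log_natCast (isBigO_refl _ _) hlog

lemma isBigO_roundBound_prod (hC : 0 < constC sigma lam gamma) (hdelta : 0 < delta) :
    (fun q : ℕ × ℕ => roundBound sigma lam gamma delta q.1 q.2) =O[atTop]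
      fun q : ℕ × ℕ => (q.1 : ℝ) * q.2 * Real.log (q.1 * q.2) := by
  have hlarge : ∀ᶠ q : ℕ × ℕ in atTop, (3 : ℝ) ≤ q.1 ∧ (1 : ℝ) ≤ q.2 := by
    filter_upwards [eventually_ge_atTop ((3, 1) : ℕ × ℕ)] with q hq
    exact_mod_cast hq
  have hD1 : (fun _ : ℕ × ℕ => (1 : ℝ)) =O[atTop] fun q => (q.2 : ℝ) :=
    IsBigO.of_bound 1 (hlarge.mono fun q hq => by simpa using hq.2)
  have hlog (q : ℕ × ℕ) (hq : (3 : ℝ) ≤ q.1 ∧ (1 : ℝ) ≤ q.2) :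
      1 ≤ Real.log q.1 ∧ Real.log q.1 ≤ Real.log (q.1 * q.2) :=
    ⟨one_le_log_of_three_le hq.1,
      Real.log_le_log (by linarith) (le_mul_of_one_le_right (by linarith) hq.2)⟩
  have hℓ1 : (fun _ : ℕ × ℕ => (1 : ℝ)) =O[atTop] fun q => Real.log (q.1 * q.2) := by
    refine IsBigO.of_bound 1 (hlarge.mono fun q hq => ?_)
    rw [norm_one, one_mul]
    exact ((hlog q hq).1.trans (hlog q hq).2).trans (Real.le_norm_self _)
  have hℓN : (fun q : ℕ × ℕ => Real.log q.1) =O[atTop] fun q => Real.log (q.1 * q.2) := by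
    refine IsBigO.of_bound 1 (hlarge.mono fun q hq => ?_)
    rw [one_mul, Real.norm_of_nonneg (zero_le_one.trans (hlog q hq).1)]
    exact (hlog q hq).2.trans (Real.le_norm_self _)
  simpa only [mul_assoc] using isBigO_roundBound hC hdelta hD1 (isBigO_refl _ _) hℓ1 hℓN
    (isBigO_refl _ _)

end LOCB

theorem theorem2_general (sigma lam gamma delta : ℝ) (hsigma : 0 < sigma) (hlam : 0 < lam)
    (hgamma : 0 < gamma) (hdelta : 0 < delta) :
    (∀ (n d : ℕ) (S : Finset (Fin n)) (p : LOCB.Path n d), lam ≤ 1 → delta / n ≤ 1 → 0 < d →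
      LOCB.EvenlyServed p →
      (∃ t : ℕ,
        ((t : ℕ∞) < LOCB.termTime sigma lam gamma delta S p ∨
            (t : ℝ) < LOCB.roundBound sigma lam gamma delta n d) ∧
          ∀ i : Fin n, LOCB.threshold n d lam (delta / n) ≤ (LOCB.count p i t : ℝ)) →
      ∃ T : ℕ, LOCB.termTime sigma lam gamma delta S p = T ∧
        (T : ℝ) < LOCB.roundBound sigma lam gamma delta n d) ∧
    (∀ d : ℕ, (fun n : ℕ => LOCB.roundBound sigma lam gamma delta n d) =O[atTop]
      fun n : ℕ => (n : ℝ) * Real.log n) ∧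
    ((fun q : ℕ × ℕ => LOCB.roundBound sigma lam gamma delta q.1 q.2) =O[atTop]
      fun q : ℕ × ℕ => (q.1 : ℝ) * q.2 * Real.log (q.1 * q.2)) := by
  have hC := LOCB.constC_pos hsigma hlam hgamma
  refine ⟨?_, LOCB.isBigO_roundBound_left hC hdelta, LOCB.isBigO_roundBound_prod hC hdelta⟩
  rintro n d S p hlam1 hdelta1 hd hp ⟨t, ht, hc⟩
  exact LOCB.exists_termTime_eq_lt_roundBound hsigma hlam hlam1 hgamma hdelta hdelta1 hd hp hc ht

theorem theorem2 (sigma lam gamma delta : ℝ) (hsigma : 0 < sigma) (hlam : 0 < lam)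
    (hgamma : 0 < gamma) (hdelta : 0 < delta) (hdelta' : delta < 1) :
    (∀ (n d k : ℕ) (Ω : Type*) [MeasurableSpace Ω] (P : Measure Ω) [IsProbabilityMeasure P]
        (theta : Fin n → LOCB.Vec d) (ν : Measure (LOCB.Vec d)) (alpha : ℝ) (S : Finset (Fin n))
        (user : ℕ → Ω → Fin n) (ctx : ℕ → Ω → Fin k → LOCB.Vec d) (arm : ℕ → Ω → Fin k)
        (noise : ℕ → Ω → ℝ),
      LOCB.IsContextLaw ν lam →
      LOCB.IsLinearBandit P theta ν sigma user ctx arm noise →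
      LOCB.PullsByLOCB P sigma lam gamma delta alpha S theta user ctx arm noise →
      -- users are served evenly
      (∀ᵐ ω ∂P, LOCB.EvenlyServed (LOCB.pathOf theta user ctx arm noise ω)) →
      -- all counts have reached the threshold at a round before termination or before the bound
      (∀ᵐ ω ∂P, ∃ t : ℕ,
        ((t : ℕ∞) < LOCB.termTime sigma lam gamma delta S
              (LOCB.pathOf theta user ctx arm noise ω) ∨
            (t : ℝ) < LOCB.roundBound sigma lam gamma delta n d) ∧
          ∀ i : Fin n, LOCB.threshold n d lam (delta / n) ≤
            (LOCB.count (LOCB.pathOf theta user ctx arm noise ω) i t : ℝ)) →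
      1 - delta ≤ P.real {ω | ∃ T : ℕ,
        LOCB.termTime sigma lam gamma delta S (LOCB.pathOf theta user ctx arm noise ω) = T ∧
          (T : ℝ) < LOCB.roundBound sigma lam gamma delta n d}) ∧
    (∀ d : ℕ, (fun n : ℕ => LOCB.roundBound sigma lam gamma delta n d) =O[atTop]
      fun n : ℕ => (n : ℝ) * Real.log n) ∧
    ((fun q : ℕ × ℕ => LOCB.roundBound sigma lam gamma delta q.1 q.2) =O[atTop]
      fun q : ℕ × ℕ => (q.1 : ℝ) * q.2 * Real.log (q.1 * q.2)) := by
  obtain ⟨hterm, hgrowth⟩ := theorem2_general sigma lam gamma delta hsigma hlam hgamma hdelta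
  refine ⟨fun n d k Ω _ P _ theta ν alpha S user ctx arm noise hν _ _ heven hcount => ?_, hgrowth⟩
  refine LOCB.one_sub_le_probReal_of_ae hdelta.le ?_
  filter_upwards [heven, hcount] with ω hω ht
  have hn : (1 : ℝ) ≤ n := by exact_mod_cast (user 0 ω).pos
  exact hterm n d S _ hν.le_one (div_le_one_of_le₀ (by linarith) (by linarith)) hν.dim_pos hω ht
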